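/- **Proposition 1.1.** Let $X$ be an irreducible reduced affine algebraic variety over $\mathbb C$. An algebraic $\mathbb C$-action on $X$ is a regular map $\varphi:\mathbb C\times X\to X$ such that $\varphi^{z}:=\varphi(z,\cdot)$ is an automorphism of the variety $X$ for every $z\in\mathbb C$, and $\varphi^{z+w}=\varphi^{z}\circ\varphi^{w}$ for all $z,w\in\mathbb C$. Let $\varphi_1,\dots,\varphi_m$ be algebraic $\mathbb C$-actions on $X$, and let $G\subseteq\operatorname{Aut}(X)$ be the group generated by all the automorphisms $\varphi_i^{z}$ ($1\le i\le m$, $z\in\mathbb C$); $G$ need not be an algebraic group. If $\dim X=1$, assume that $G$ is not the trivial group. Suppose that the $G$-orbit $\{g(x)\,:\,g\in G\}$ of a general point $x\in X$ is not dense in $X$, in the sense that it contains no nonempty Zariski open subset of $X$; that is, there is a nonempty Zariski open set $U\subseteq X$ such that for no $x\in U$ does the orbit of $x$ contain a nonempty Zariski open subset of $X$. Then there exist an irreducible algebraic variety $X_G$ over $\mathbb C$ with $$0<\dim X_G<\dim X$$ and a dominant rational map $\pi:X\dashrightarrow X_G$ over $\mathbb C$ which is $G$-invariant, i.e. $\pi\circ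 g=\pi$ as rational maps for every $g\in G$. -/

import Mathlib

open CategoryTheory AlgebraicGeometry

noncomputable section

/-- `Spec ℂ`. -/
abbrev SpecC : Scheme.{0} := Spec (CommRingCat.of ℂ)

/-- The constant function with value `z` on a `ℂ`-scheme `X`. -/
def constFun (X : Scheme.{0}) [X.Over SpecC] (z : ℂ) : Γ(X, ⊤) :=
  (X ↘ SpecC).appTop ((Scheme.ΓSpecIso (CommRingCat.of ℂ)).inv z)

/-- The closed embedding `X ⟶ 𝔸¹ × X`, `x ↦ (z, x)`. Here `𝔸(PUnit; X)`, the affine line over `X`,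
is the product `𝔸¹ × X`, whose points over `ℂ` are the pairs in `ℂ × X`. -/
def sliceAt (X : Scheme.{0}) [X.Over SpecC] (z : ℂ) : X ⟶ 𝔸(PUnit.{1}; X) :=
  AffineSpace.homOfVector (𝟙 X) (fun _ => constFun X z)

/-- An algebraic action of the additive group `ℂ` on a `ℂ`-scheme `X`: a morphism
`φ : ℂ × X ⟶ X` over `ℂ` such that every `φ^z = φ(z, ·)` is an automorphism of `X` and
`φ^(z + w) = φ^z ∘ φ^w`. -/
structure AlgCAction (X : Scheme.{0}) [X.Over SpecC] where
  /-- The morphism `φ : ℂ × X ⟶ X`. -/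
  hom : 𝔸(PUnit.{1}; X) ⟶ X
  hom_over : hom ≫ (X ↘ SpecC) = (𝔸(PUnit.{1}; X) ↘ X) ≫ (X ↘ SpecC)
  isIso_slice : ∀ z : ℂ, IsIso (sliceAt X z ≫ hom)
  slice_add : ∀ z w : ℂ,
    sliceAt X (z + w) ≫ hom = (sliceAt X w ≫ hom) ≫ (sliceAt X z ≫ hom)

/-- The automorphism `φ^z` of `X`. -/
def AlgCAction.flow {X : Scheme.{0}} [X.Over SpecC] (φ : AlgCAction X) (z : ℂ) : Aut X :=
  haveI := φ.isIso_slice z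
  asIso (sliceAt X z ≫ φ.hom)

/-- The group of automorphisms of `X` generated by a family of algebraic `ℂ`-actions, that is, by
all the automorphisms `φᵢ^z`. -/
def generatedGroup {X : Scheme.{0}} [X.Over SpecC] {ι : Type} (φ : ι → AlgCAction X) :
    Subgroup (Aut X) :=
  Subgroup.closure (Set.range fun p : ι × ℂ => (φ p.1).flow p.2)

/-- The orbit `{g(x) : g ∈ G}` of a point under a group of automorphisms. -/
def autOrbit {X : Scheme.{0}} (G : Subgroup (Aut X)) (x : X) : Set X :=
  {y | ∃ g ∈ G, g.hom x = y}

/-- An automorphism, viewed as a rational map, is dominant, so that a rational map can be composed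
with it. -/
instance Aut.isDominant_toRationalMap {X : Scheme.{0}} (g : Aut X) :
    (Scheme.Hom.toRationalMap g.hom).IsDominant := by
  rw [Scheme.PartialMap.isDominant_toRationalMap_iff]
  have h : IsIso g.hom := Iso.isIso_hom g
  have h' : IsDominant g.hom := inferInstance
  exact (IsDominant.comp_iff X.topIso.hom g.hom).mpr h'

/-- A rational map `π` on `X` is `G`-invariant: `π ∘ g = π` as rational maps, for all `g ∈ G`. -/
def IsInvariantRationalMap {X Y : Scheme.{0}} [IrreducibleSpace X] (G : Subgroup (Aut X))
    (π : X ⤏ Y) : Prop :=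
  ∀ g ∈ G, (Scheme.Hom.toRationalMap g.hom).comp π = π

/-- `W` contains a nonempty Zariski open subset of the variety `X`, where the points of the variety
are the closed points of the scheme `X`, with the induced topology. -/
def ContainsOpenSubset {X : Scheme.{0}} (W : Set X) : Prop :=
  ∃ V : X.Opens, (V : Set X).Nonempty ∧ (V : Set X) ∩ closedPoints X ⊆ W

/-- The property `P` holds for a general (closed) point of the variety `X`: it holds for all points
of some nonempty Zariski open subset. -/
def ForGeneralPoint (X : Scheme.{0}) (P : X → Prop) : Prop :=
  ∃ U : X.Opens, (U : Set X).Nonempty ∧ ∀ x ∈ (U : Set X) ∩ closedPoints X, P x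

/-- `X` is an irreducible (reduced) algebraic variety over `ℂ`. -/
structure IsIrreducibleVariety (X : Scheme.{0}) [X.Over SpecC] : Prop where
  isIntegral : AlgebraicGeometry.IsIntegral X
  isSeparated : IsSeparated (X ↘ SpecC)
  locallyOfFiniteType : LocallyOfFiniteType (X ↘ SpecC)
  quasiCompact : QuasiCompact (X ↘ SpecC)

end

/-!
Write `A` for the algebra of functions on `X`, `K` for its fraction field and `H` for the group of
comorphisms of the elements of `G`. It suffices to find a nonconstant `G`-invariant rational
function `a / b ∈ K`: it defines a dominant invariant rational map to the affine line, which has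
dimension one, and the dimension of `X` is at least two. Indeed `K ≠ ℂ` excludes dimension zero. In
dimension one, `K` is algebraic over `ℂ(a / b)`, so that every function on `X` has a finite
`H`-orbit; as the functions `h(f)` depend polynomially on the parameters of the flows, they are
constant in the parameters, and `G` is trivial (`generatedGroup_eq_bot_of_transcendental`).

Suppose that all invariant rational functions are constant. Then the graphs of the elements of `G`
are dense in `X × X`: if `F = ∑ cᵢ ⊗ bᵢ` vanishes on all of them, with `bᵢ` linearly independent
over `ℂ`, then `∑ cᵢ h(bᵢ) = 0` for all `h ∈ H`, which is impossible by Artin's lemma on linear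
independence over the fixed field (`exists_productMap_ne_zero`). Each element of `G` lies in an
algebraic family, a product of flows with variable times. The functions on `X × X` that vanish on
the graphs of a family form a prime ideal; these primes have intersection zero and any two of them
contain a third one, so that by the descending chain condition one of them is zero
(`exists_isAlgebraicFamily_injective`). For that family the map `(z, x) ↦ (x, h_z(x))` is dominant,
and by Chevalley's theorem its image contains a nonempty open subset of `X × X`, whose fibre over a
general `x` is an open subset of `X` inside the orbit of `x` (`exists_open_orbit`). This contradicts
the assumption on the orbits.
-/

/-! ### Algebraic families of automorphisms -/

section Families

variable {k A : Type*} [Field k] [CommRing A] [Algebra k A]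

/-- A set `S` of automorphisms of the `k`-algebra `A` is an *algebraic family* if it is of the form
`{h_z : z ∈ kⁿ}` where `h_z` depends polynomially on `z`: there is a homomorphism
`Ψ : A → A[n]` to a polynomial ring such that `h_z(a)` is the value of `Ψ(a)` at `z`.
Geometrically this is a morphism `𝔸ⁿ × Spec A → Spec A` all of whose slices are automorphisms. -/
def IsAlgebraicFamily (S : Set (A ≃ₐ[k] A)) : Prop :=
  ∃ (n : Type) (_ : Finite n) (Ψ : A →ₐ[k] MvPolynomial n A) (h : (n → k) → (A ≃ₐ[k] A)),
    S = Set.range h ∧ ∀ z a, h z a = MvPolynomial.eval (fun i => algebraMap k A (z i)) (Ψ a)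

theorem isAlgebraicFamily_one : IsAlgebraicFamily ({1} : Set (A ≃ₐ[k] A)) := by
  refine ⟨Empty, inferInstance, Algebra.ofId A (MvPolynomial Empty A) |>.restrictScalars k,
    fun _ => 1, Set.range_const.symm, fun z a => ?_⟩
  simp [Algebra.ofId_apply, MvPolynomial.algebraMap_eq]

open scoped Pointwise in
theorem IsAlgebraicFamily.mul {S T : Set (A ≃ₐ[k] A)} (hS : IsAlgebraicFamily S)
    (hT : IsAlgebraicFamily T) : IsAlgebraicFamily (S * T) := by
  obtain ⟨n, _, Ψ, h, rfl, hΨ⟩ := hS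
  obtain ⟨m, _, Θ, g, rfl, hΘ⟩ := hT
  let E : MvPolynomial m A →+* MvPolynomial (n ⊕ m) A :=
    MvPolynomial.eval₂Hom
      ((MvPolynomial.rename Sum.inl : MvPolynomial n A →ₐ[A] _).toRingHom.comp Ψ.toRingHom)
      (fun j => MvPolynomial.X (Sum.inr j))
  refine ⟨n ⊕ m, inferInstance,
    { E.comp Θ.toRingHom with
      commutes' := fun r => ?_ }, fun z => h (fun i => z (Sum.inl i)) * g (fun j => z (Sum.inr j)),
    ?_, fun z a => ?_⟩
  · have h1 : Θ (algebraMap k A r) = MvPolynomial.C (algebraMap k A r) := by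
      rw [AlgHom.commutes]; rfl
    have h2 : Ψ (algebraMap k A r) = MvPolynomial.C (algebraMap k A r) := by
      rw [AlgHom.commutes]; rfl
    change E (Θ (algebraMap k A r)) = MvPolynomial.C (algebraMap k A r)
    rw [h1]
    change MvPolynomial.eval₂ _ _ _ = _
    rw [MvPolynomial.eval₂_C]
    change MvPolynomial.rename Sum.inl (Ψ (algebraMap k A r)) = _
    rw [h2, MvPolynomial.rename_C]
  · ext f
    constructor
    · rintro ⟨_, ⟨z, rfl⟩, _, ⟨w, rfl⟩, rfl⟩
      exact ⟨Sum.elim z w, rfl⟩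
    · rintro ⟨z, rfl⟩
      exact ⟨_, ⟨_, rfl⟩, _, ⟨_, rfl⟩, rfl⟩
  · change h _ (g _ a) = MvPolynomial.eval _ (E (Θ a))
    rw [hΘ]
    generalize Θ a = p
    suffices H : (h (fun i => z (Sum.inl i)) : A →+* A).comp
        (MvPolynomial.eval fun j => algebraMap k A (z (Sum.inr j))) =
        (MvPolynomial.eval fun i => algebraMap k A (z i)).comp E from
      congrArg (fun f : MvPolynomial m A →+* A => f p) H
    apply MvPolynomial.ringHom_ext
    · intro a
      simp [E, hΨ, MvPolynomial.eval_rename, Function.comp_def]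
    · intro j
      simp [E]

end Families

/-! ### Separating functions on `X × X` by graphs of group elements -/

section Separation

open scoped TensorProduct

variable {k A : Type*} [Field k] [CommRing A] [Algebra k A]

theorem sum_repr_tmul_basis {I : Type*} (b : Module.Basis I k A) (F : A ⊗[k] A) :
    F = ∑ i ∈ ((Algebra.TensorProduct.basis A b).repr F).support,
      (Algebra.TensorProduct.basis A b).repr F i ⊗ₜ[k] b i := by
  have := (Algebra.TensorProduct.basis A b).linearCombination_repr F
  rw [Finsupp.linearCombination_apply, Finsupp.sum] at this
  nth_rw 1 [← this]
  refine Finset.sum_congr rfl fun i _ => ?_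
  simp [Algebra.TensorProduct.basis_apply, TensorProduct.smul_tmul']

variable [IsDomain A]

/-- Artin's argument: if the only elements of `Frac A` fixed by a group `H` of automorphisms of `A`
are the constants, then a nonzero function `F(x, y)` on `Spec A × Spec A` cannot vanish on the
graphs of all elements of `H`. -/
theorem exists_productMap_ne_zero (H : Subgroup (A ≃ₐ[k] A))
    (hH : ∀ x : FractionRing A, (∀ h ∈ H,
        IsFractionRing.fieldEquivOfAlgEquivHom k (FractionRing A) h x = x) →
      x ∈ Set.range (algebraMap k (FractionRing A)))
    {F : A ⊗[k] A} (hF : F ≠ 0) :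
    ∃ h ∈ H, Algebra.TensorProduct.productMap (AlgHom.id k A) (h : A →ₐ[k] A) F ≠ 0 := by
  classical
  by_contra! hcon
  let K := FractionRing A
  let θ : (A ≃ₐ[k] A) →* Gal(K/k) := IsFractionRing.fieldEquivOfAlgEquivHom k K
  have hθ (h : A ≃ₐ[k] A) (a : A) : θ h (algebraMap A K a) = algebraMap A K (h a) :=
    IsFractionRing.fieldEquivOfAlgEquiv_algebraMap k K K h a
  have hinj : Function.Injective (algebraMap A K) := IsFractionRing.injective A K
  let b := Module.Basis.ofVectorSpace k A
  let c := (Algebra.TensorProduct.basis A b).repr F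
  have hc : c ≠ 0 := by simpa [c] using hF
  have hFc : F = ∑ i ∈ c.support, c i ⊗ₜ[k] b i := sum_repr_tmul_basis b F
  have hrel (h) (hh : h ∈ H) : ∑ i ∈ c.support, c i * h (b i) = 0 := by
    have := hcon h hh
    rw [hFc, map_sum] at this
    simpa using this
  let e : _ → K := fun i => algebraMap A K (b i)
  have he : Function.Injective e := hinj.comp b.injective
  have hek : LinearIndependent k e :=
    b.linearIndependent.map' (IsScalarTower.toAlgHom k A K).toLinearMap
      (LinearMap.ker_eq_bot.2 hinj)
  let G := H.map θ
  have hfix (x : FixedPoints.subfield G K) : ∃ r : k, algebraMap k K r = x :=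
    hH x fun h hh => x.2 ⟨θ h, h, hh, rfl⟩
  choose ρ hρ using hfix
  have heF : LinearIndependent (FixedPoints.subfield G K) e := by
    rw [linearIndependent_iff']
    intro s g hg i hi
    have h0 := linearIndependent_iff'.1 hek s (fun j => ρ (g j)) (by
      rw [← hg]
      refine Finset.sum_congr rfl fun j _ => ?_
      rw [Algebra.smul_def, hρ]; rfl) i hi
    apply Subtype.ext
    rw [← hρ, h0, map_zero]; rfl
  let s : Finset K := c.support.image e
  have hs : LinearIndepOn (FixedPoints.subfield G K) id (s : Set K) :=
    heF.linearIndepOn_id.mono fun x hx => by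
      obtain ⟨i, -, rfl⟩ := Finset.mem_image.1 hx
      exact ⟨i, rfl⟩
  -- Linear independence over the fixed field gives linear independence of the functions
  -- `h ↦ h (b i)` on the group over `K`, which contradicts the relations `hrel`.
  have key := FixedPoints.linearIndependent_smul_of_linearIndependent G K hs
  obtain ⟨i, hi⟩ := Finsupp.support_nonempty_iff.2 hc
  have := linearIndepOn_finset_iff.1 key
    (fun x => if hx : ∃ i, e i = x then algebraMap A K (c hx.choose) else 0) (by
      ext ⟨_, h, hh, rfl⟩
      rw [Finset.sum_image he.injOn]
      have := congrArg (algebraMap A K) (hrel h hh)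
      rw [map_sum, map_zero] at this
      rw [Finset.sum_apply, Pi.zero_apply, ← this]
      refine Finset.sum_congr rfl fun j _ => ?_
      have hex : ∃ i, e i = e j := ⟨j, rfl⟩
      have : hex.choose = j := he hex.choose_spec
      rw [Pi.smul_apply, dif_pos hex, this, map_mul, ← hθ]; rfl) (e i)
    (Finset.mem_image_of_mem e hi)
  have hex : ∃ j, e j = e i := ⟨i, rfl⟩
  rw [dif_pos hex, he hex.choose_spec] at this
  exact Finsupp.mem_support_iff.1 hi (hinj (by rw [this, map_zero]))

open scoped Pointwise in
/-- Under the hypothesis of `exists_productMap_ne_zero`, a single algebraic family is enough to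
separate the nonzero functions on `Spec A × Spec A` from zero, that is, the map
`(z, x) ↦ (x, h_z(x))` is dominant. For an algebraic family `S`, the functions vanishing on its
graphs form a prime ideal, which shrinks when `S` is multiplied by another family; primes of a
Noetherian ring satisfy the descending chain condition. -/
theorem exists_isAlgebraicFamily_injective [Infinite k] [Algebra.FiniteType k A]
    (H : Subgroup (A ≃ₐ[k] A))
    (hfam : ∀ h ∈ H, ∃ S : Set (A ≃ₐ[k] A), IsAlgebraicFamily S ∧ S ⊆ H ∧ 1 ∈ S ∧ h ∈ S)
    (hH : ∀ x : FractionRing A, (∀ h ∈ H,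
        IsFractionRing.fieldEquivOfAlgEquivHom k (FractionRing A) h x = x) →
      x ∈ Set.range (algebraMap k (FractionRing A))) :
    ∃ (n : Type) (_ : Finite n) (Ψ : A →ₐ[k] MvPolynomial n A) (h : (n → k) → (A ≃ₐ[k] A)),
      (∀ z, h z ∈ H) ∧
      (∀ z a, h z a = MvPolynomial.eval (fun i => algebraMap k A (z i)) (Ψ a)) ∧
      Function.Injective (Algebra.TensorProduct.productMap
        (IsScalarTower.toAlgHom k A (MvPolynomial n A)) Ψ) := by
  have : IsNoetherianRing A := Algebra.FiniteType.isNoetherianRing k A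
  have : IsNoetherianRing (A ⊗[k] A) := Algebra.FiniteType.isNoetherianRing A _
  let P (S : Set (A ≃ₐ[k] A)) : Ideal (A ⊗[k] A) := ⨅ h ∈ S, RingHom.ker
    (Algebra.TensorProduct.productMap (AlgHom.id k A) (h : A →ₐ[k] A))
  have hP (S F) : F ∈ P S ↔
      ∀ h ∈ S, Algebra.TensorProduct.productMap (AlgHom.id k A) (h : A →ₐ[k] A) F = 0 := by
    simp [P, RingHom.mem_ker, Submodule.mem_iInf]
  have hker (n : Type) [Finite n] (Ψ : A →ₐ[k] MvPolynomial n A) (h : (n → k) → (A ≃ₐ[k] A))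
      (hΨ : ∀ z a, h z a = MvPolynomial.eval (fun i => algebraMap k A (z i)) (Ψ a)) :
      P (Set.range h) = RingHom.ker (Algebra.TensorProduct.productMap
        (IsScalarTower.toAlgHom k A (MvPolynomial n A)) Ψ) := by
    have hev (z : n → k) (F : A ⊗[k] A) :
        Algebra.TensorProduct.productMap (AlgHom.id k A) (h z : A →ₐ[k] A) F =
        MvPolynomial.eval (fun i => algebraMap k A (z i))
          (Algebra.TensorProduct.productMap
            (IsScalarTower.toAlgHom k A (MvPolynomial n A)) Ψ F) := by
      induction F with
      | zero => simp
      | add x y hx hy => simp only [map_add, hx, hy]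
      | tmul a b => simp [hΨ, MvPolynomial.algebraMap_eq]
    ext F
    rw [hP, RingHom.mem_ker]
    constructor
    · intro hF
      refine MvPolynomial.funext_set (fun _ => Set.range (algebraMap k A)) (fun _ =>
        Set.infinite_range_of_injective (FaithfulSMul.algebraMap_injective k A)) fun x hx => ?_
      choose z hz using fun i => hx i trivial
      obtain rfl : (fun i => algebraMap k A (z i)) = x := funext hz
      rw [map_zero]
      exact (hev z F).symm.trans (hF _ ⟨z, rfl⟩)
    · rintro hF _ ⟨z, rfl⟩
      rw [hev, hF, map_zero]
  have hprime (S) (hS : IsAlgebraicFamily S) : (P S).IsPrime := by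
    obtain ⟨n, _, Ψ, h, rfl, hΨ⟩ := hS
    rw [hker n Ψ h hΨ]
    exact RingHom.ker_isPrime _
  let 𝓢 : Set (Set (A ≃ₐ[k] A)) := {S | IsAlgebraicFamily S ∧ S ⊆ H ∧ 1 ∈ S}
  have hne : 𝓢.Nonempty := ⟨{1}, isAlgebraicFamily_one, by simp [H.one_mem], rfl⟩
  obtain ⟨S, ⟨hS, hSH, h1S⟩, hmin⟩ : ∃ S ∈ 𝓢, ∀ T ∈ 𝓢, ¬ (P T).height < (P S).height := by
    obtain ⟨S, hS, h⟩ := WellFounded.has_min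
      (InvImage.wf (fun S => (P S).height) (wellFounded_lt (α := ℕ∞))) 𝓢 hne
    exact ⟨S, hS, h⟩
  have hbot : P S = ⊥ := by
    by_contra hcon
    obtain ⟨F, hFS, hF⟩ := Submodule.exists_mem_ne_zero_of_ne_bot hcon
    obtain ⟨h, hh, hne⟩ := exists_productMap_ne_zero H hH hF
    obtain ⟨T, hT, hTH, h1T, hhT⟩ := hfam h hh
    have hST : S * T ∈ 𝓢 := by
      refine ⟨hS.mul hT, ?_, ⟨1, h1S, 1, h1T, mul_one 1⟩⟩
      rintro _ ⟨s, hs, t, ht, rfl⟩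
      exact H.mul_mem (hSH hs) (hTH ht)
    have hle : P (S * T) ≤ P S := fun G hG => (hP _ _).2 fun s hs =>
      (hP _ _).1 hG s ⟨s, hs, 1, h1T, mul_one s⟩
    have hlt : P (S * T) < P S := by
      refine lt_of_le_of_ne hle fun heq => hne ?_
      rw [← heq, hP] at hFS
      exact hFS h ⟨1, h1S, h, hhT, one_mul h⟩
    have := hprime _ hS
    have := hprime _ (hS.mul hT)
    exact hmin _ hST (Ideal.height_strict_mono_of_isPrime_of_isPrime hlt)
  obtain ⟨n, hn, Ψ, h, rfl, hΨ⟩ := hS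
  refine ⟨n, hn, Ψ, h, fun z => hSH ⟨z, rfl⟩, hΨ, ?_⟩
  rw [hker n Ψ h hΨ] at hbot
  exact (RingHom.injective_iff_ker_eq_bot _).2 hbot

end Separation

/-! ### Open orbits -/

section Points

open scoped TensorProduct

variable {k : Type*} [Field k] [IsAlgClosed k]

/-- The Nullstellensatz over an algebraically closed field: maximal ideals of finitely generated
algebras are kernels of `k`-points. -/
theorem exists_algHom_ker_eq {R : Type*} [CommRing R] [Algebra k R] [Algebra.FiniteType k R]
    (M : Ideal R) [M.IsMaximal] : ∃ χ : R →ₐ[k] k, RingHom.ker χ = M := by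
  let _ := Ideal.Quotient.field M
  have : Module.Finite k (R ⧸ M) := finite_of_finite_type_of_isJacobsonRing k (R ⧸ M)
  have hb := IsAlgClosed.algebraMap_bijective_of_isIntegral (k := k) (K := R ⧸ M)
  let e : k ≃ₐ[k] (R ⧸ M) := AlgEquiv.ofBijective (Algebra.ofId k (R ⧸ M)) hb
  refine ⟨(e.symm : (R ⧸ M) →ₐ[k] k).comp (Ideal.Quotient.mkₐ k M), ?_⟩
  ext r
  simp [RingHom.mem_ker, Ideal.Quotient.eq_zero_iff_mem]

theorem AlgHom.eq_of_ker_le {k R : Type*} [Field k] [CommRing R] [Algebra k R] {χ ψ : R →ₐ[k] k}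
    (h : RingHom.ker χ ≤ RingHom.ker ψ) : χ = ψ := by
  ext r
  have : r - algebraMap k R (χ r) ∈ RingHom.ker ψ := h (by simp [RingHom.mem_ker])
  rw [RingHom.mem_ker, map_sub, AlgHom.commutes, sub_eq_zero] at this
  exact this.symm

/-- A dominant morphism of affine varieties hits all points of a nonempty open subset
(Chevalley's theorem, on `k`-points). -/
theorem exists_ne_zero_forall_exists_comp_eq {B R : Type*} [CommRing B] [CommRing R] [IsDomain R]
    [Algebra k B] [Algebra k R] [Algebra.FiniteType k B] [Algebra.FiniteType k R]
    (f : B →ₐ[k] R) (hf : Function.Injective f) :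
    ∃ F : B, F ≠ 0 ∧ ∀ ψ : B →ₐ[k] k, ψ F ≠ 0 → ∃ χ : R →ₐ[k] k, χ.comp f = ψ := by
  have : IsDomain B := hf.isDomain f.toRingHom
  have : IsNoetherianRing B := Algebra.FiniteType.isNoetherianRing k B
  have hfin : (f : B →+* R).FiniteType := by
    refine RingHom.FiniteType.of_comp_finiteType (f := algebraMap k B) ?_
    rw [f.comp_algebraMap, RingHom.finiteType_algebraMap]
    infer_instance
  obtain ⟨S, hS⟩ := PrimeSpectrum.exists_constructibleSetData_iff.2
    (PrimeSpectrum.isConstructible_range_comap (RingHom.FinitePresentation.of_finiteType.1 hfin))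
  have hbot : (⟨⊥, Ideal.isPrime_bot⟩ : PrimeSpectrum B) ∈ S.toSet := by
    rw [hS]
    refine ⟨⟨⊥, Ideal.isPrime_bot⟩, PrimeSpectrum.ext ?_⟩
    exact (RingHom.injective_iff_ker_eq_bot _).1 hf
  -- The piece of the constructible image through the generic point is a basic open set.
  obtain ⟨C, hC, hCbot⟩ : ∃ C ∈ S, (⟨⊥, Ideal.isPrime_bot⟩ : PrimeSpectrum B) ∈ C.toSet := by
    simpa [PrimeSpectrum.ConstructibleSetData.toSet] using hbot
  have hg : Set.range C.g ⊆ {0} := fun x hx => by simpa using hCbot.1 hx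
  have hF : C.f ≠ 0 := fun h => hCbot.2 (by simp [h])
  refine ⟨C.f, hF, fun ψ hψ => ?_⟩
  have hmax : (RingHom.ker ψ).IsMaximal :=
    RingHom.ker_isMaximal_of_surjective _ fun r => ⟨algebraMap k B r, by simp⟩
  have hmem : (⟨RingHom.ker ψ, hmax.isPrime⟩ : PrimeSpectrum B) ∈ S.toSet := by
    refine Set.mem_biUnion hC ⟨fun x hx => ?_, fun h => hψ ?_⟩
    · rw [hg hx]
      exact Ideal.zero_mem _
    · exact h rfl
  rw [hS] at hmem
  obtain ⟨Q, hQ⟩ := hmem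
  obtain ⟨M, hM, hQM⟩ := Ideal.exists_le_maximal Q.asIdeal Q.isPrime.ne_top
  obtain ⟨χ, rfl⟩ := exists_algHom_ker_eq (k := k) M
  refine ⟨χ, (AlgHom.eq_of_ker_le fun b hb => ?_).symm⟩
  have : b ∈ Ideal.comap (f : B →+* R) Q.asIdeal := by
    rw [← PrimeSpectrum.comap_asIdeal, hQ]
    exact hb
  exact hQM this

/-- If there are no nonconstant invariant rational functions, then the orbit of a general point
contains a nonempty open set. -/
theorem exists_open_orbit {A : Type*} [CommRing A] [IsDomain A] [Algebra k A]
    [Algebra.FiniteType k A] (H : Subgroup (A ≃ₐ[k] A))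
    (hfam : ∀ h ∈ H, ∃ S : Set (A ≃ₐ[k] A), IsAlgebraicFamily S ∧ S ⊆ H ∧ 1 ∈ S ∧ h ∈ S)
    (hH : ∀ x : FractionRing A, (∀ h ∈ H,
        IsFractionRing.fieldEquivOfAlgEquivHom k (FractionRing A) h x = x) →
      x ∈ Set.range (algebraMap k (FractionRing A))) :
    ∃ a : A, a ≠ 0 ∧ ∀ x : A →ₐ[k] k, x a ≠ 0 → ∃ f : A, f ≠ 0 ∧
      ∀ y : A →ₐ[k] k, y f ≠ 0 → ∃ h ∈ H, y = x.comp (h : A →ₐ[k] A) := by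
  have : Infinite k := IsAlgClosed.instInfinite
  obtain ⟨n, _, Ψ, h, hh, hΨ, hinj⟩ := exists_isAlgebraicFamily_injective H hfam hH
  have : Algebra.FiniteType k (A ⊗[k] A) :=
    Algebra.FiniteType.trans (S := A) inferInstance inferInstance
  have : Algebra.FiniteType k (MvPolynomial n A) :=
    Algebra.FiniteType.trans (S := A) inferInstance inferInstance
  obtain ⟨F, hF, hlift⟩ := exists_ne_zero_forall_exists_comp_eq _ hinj
  let b := Module.Basis.ofVectorSpace k A
  let c := (Algebra.TensorProduct.basis A b).repr F
  have hc : c ≠ 0 := by simpa [c] using hF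
  have hFc : F = ∑ i ∈ c.support, c i ⊗ₜ[k] b i := sum_repr_tmul_basis b F
  obtain ⟨i, hi⟩ := Finsupp.support_nonempty_iff.2 hc
  -- For `x` with `cᵢ(x) ≠ 0`, the function `F(x, ·)` is not zero, and the points at which it does
  -- not vanish lie in the orbit of `x`.
  refine ⟨c i, Finsupp.mem_support_iff.1 hi, fun x hx => ?_⟩
  refine ⟨∑ j ∈ c.support, x (c j) • b j, fun h0 =>
    hx (linearIndependent_iff'.1 b.linearIndependent _ _ h0 i hi), fun y hy => ?_⟩
  obtain ⟨χ, hχ⟩ := hlift (Algebra.TensorProduct.productMap x y) (by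
    rw [hFc, map_sum]
    simpa using hy)
  have hχx (a : A) : χ (MvPolynomial.C a) = x a := by
    simpa [MvPolynomial.algebraMap_eq] using congrArg (fun f => f (a ⊗ₜ[k] 1)) hχ
  have hχy (a : A) : χ (Ψ a) = y a := by
    simpa using congrArg (fun f => f (1 ⊗ₜ[k] a)) hχ
  -- The lifted point of `𝔸ⁿ × X` is `(z, x)`, and it is mapped to `(x, y)`, so `y = h_z(x)`.
  let z : n → k := fun i => χ (MvPolynomial.X i)
  refine ⟨h z, hh z, AlgHom.ext fun a => ?_⟩
  have key : (χ : MvPolynomial n A →+* k) =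
      (x : A →+* k).comp (MvPolynomial.eval fun i => algebraMap k A (z i)) := by
    apply MvPolynomial.ringHom_ext
    · intro a
      simp [hχx]
    · intro i
      simp [z]
  rw [← hχy, AlgHom.comp_apply]
  change _ = x (h z a)
  rw [hΨ]
  exact congrArg (fun f : MvPolynomial n A →+* k => f (Ψ a)) key

end Points

/-! ### Transcendence degree one -/

section DimensionOne

variable {k A : Type*} [Field k] [CommRing A] [IsDomain A] [Algebra k A]

/-- An affine domain of Krull dimension at most one has transcendence degree at most one. -/
theorem trdeg_le_one [Algebra.FiniteType k A] [Ring.KrullDimLE 1 A] : Algebra.trdeg k A ≤ 1 := by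
  obtain ⟨s, g, hg, hint⟩ := exists_integral_inj_algHom_of_fg k A
  algebraize [g.toRingHom]
  have : Algebra.IsIntegral (MvPolynomial (Fin s) k) A := ⟨hint⟩
  have hinj : Function.Injective (algebraMap (MvPolynomial (Fin s) k) A) := hg
  have : FaithfulSMul (MvPolynomial (Fin s) k) A :=
    (faithfulSMul_iff_algebraMap_injective _ _).2 hinj
  have htr := lift_trdeg_add_eq k (MvPolynomial (Fin s) k) A
  rw [MvPolynomial.trdeg_of_isDomain, trdeg_eq_zero (R := MvPolynomial (Fin s) k)] at htr
  have hs : s ≤ 1 := by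
    clear htr
    by_contra! hs
    -- A prime over `(X₀)` is nonzero, hence maximal, but `(X₀)` is not maximal.
    let i : Fin s := ⟨0, by omega⟩
    let j : Fin s := ⟨1, hs⟩
    have hij : j ≠ i := by simp [i, j]
    let ev : MvPolynomial (Fin s) k →ₐ[k] MvPolynomial (Fin s) k :=
      MvPolynomial.aeval (Function.update MvPolynomial.X i 0)
    let P := RingHom.ker ev
    have hP : P.IsPrime := RingHom.ker_isPrime _
    obtain ⟨Q, hQ, hQP⟩ := Ideal.exists_ideal_over_prime_of_isIntegral_of_isDomain (S := A) P (by
      rw [(RingHom.injective_iff_ker_eq_bot _).1 hinj]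
      exact bot_le)
    have hXi : (MvPolynomial.X i : MvPolynomial (Fin s) k) ∈ P := by
      simp [P, RingHom.mem_ker, ev]
    have hQ0 : Q ≠ ⊥ := by
      rintro rfl
      rw [← hQP, Ideal.mem_comap, Ideal.mem_bot, map_eq_zero_iff _ hinj] at hXi
      exact MvPolynomial.X_ne_zero i hXi
    have := Ring.krullDimLE_one_iff_of_noZeroDivisors.1 ‹_› Q hQ0 hQ
    have hmax : P.IsMaximal := hQP ▸ Ideal.isMaximal_comap_of_isIntegral_of_isMaximal Q
    have hlt : P < RingHom.ker (MvPolynomial.aeval (0 : Fin s → k)) := by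
      refine lt_of_le_of_ne (fun p hp => ?_) fun heq => ?_
      · have h0 : ev p = 0 := hp
        have : (MvPolynomial.aeval (0 : Fin s → k)) (ev p) =
            MvPolynomial.aeval (0 : Fin s → k) p := by
          rw [← AlgHom.comp_apply]
          congr 1
          ext l
          by_cases hl : l = i
          · simp [ev, hl]
          · simp [ev, hl]
        rw [RingHom.mem_ker, ← this, h0, map_zero]
      · have : (MvPolynomial.X j : MvPolynomial (Fin s) k) ∈ P := by
          rw [heq]
          simp [RingHom.mem_ker]
        simp [P, RingHom.mem_ker, ev, hij] at this
    exact hlt.ne (hmax.eq_of_le (RingHom.ker_ne_top _) hlt.le)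
  rw [← Cardinal.lift_le_one_iff, ← htr]
  simpa using hs

/-- If the function field of `A` has transcendence degree one and a group `H` of automorphisms
fixes a nonconstant rational function, then `H` moves each element of `A` within a finite set, the
roots of a polynomial with fixed coefficients. -/
theorem finite_orbit_of_transcendental (htr : Algebra.trdeg k A ≤ 1) (H : Subgroup (A ≃ₐ[k] A))
    {x : FractionRing A} (hx : Transcendental k x)
    (hxH : ∀ h ∈ H, IsFractionRing.fieldEquivOfAlgEquivHom k (FractionRing A) h x = x) (a : A) :
    {b : A | ∃ h ∈ H, h a = b}.Finite := by
  classical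
  let K := FractionRing A
  have htrK : Algebra.trdeg k K ≤ 1 := by
    have := trdeg_add_eq k A (A := K)
    have hK : Algebra.IsAlgebraic A K :=
      (IsFractionRing.comap_isAlgebraic_iff (K := K)).2 inferInstance
    rw [trdeg_eq_zero (R := A), add_zero] at this
    exact this ▸ htr
  let X : Unit → K := fun _ => x
  have hX : AlgebraicIndependent k X := algebraicIndependent_unique_type_iff.2 hx
  have hb : IsTranscendenceBasis k X :=
    hX.isTranscendenceBasis_of_lift_trdeg_le_of_finite (by simpa using htrK)
  obtain ⟨p, hp, hpa⟩ := hb.isAlgebraic.isAlgebraic (algebraMap A K a)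
  let q : Polynomial K := p.map (algebraMap (Algebra.adjoin k (Set.range X)) K)
  have hq : q ≠ 0 := (Polynomial.map_ne_zero_iff Subtype.val_injective).2 hp
  have hqa : q.eval (algebraMap A K a) = 0 := by
    rwa [Polynomial.eval_map_algebraMap]
  refine (q.roots.toFinset.finite_toSet.preimage (IsFractionRing.injective A K).injOn).subset ?_
  rintro _ ⟨h, hh, rfl⟩
  let θ := IsFractionRing.fieldEquivOfAlgEquivHom k K h
  have hθ : θ (algebraMap A K a) = algebraMap A K (h a) :=
    IsFractionRing.fieldEquivOfAlgEquiv_algebraMap k K K h a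
  have hfix : (θ : K →ₐ[k] K).comp (Algebra.adjoin k (Set.range X)).val =
      (Algebra.adjoin k (Set.range X)).val := by
    refine AlgHom.adjoin_ext ?_
    rintro _ ⟨_, rfl⟩
    exact hxH h hh
  have hqθ : q.map (θ : K →+* K) = q := by
    rw [Polynomial.map_map]
    congr 1
    exact congrArg AlgHom.toRingHom hfix
  simp only [Set.mem_preimage, SetLike.mem_coe, Multiset.mem_toFinset]
  rw [Polynomial.mem_roots hq, Polynomial.IsRoot, ← hqθ, ← hθ]
  refine (Polynomial.eval_map_apply (θ : K →+* K) _).trans ?_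
  rw [hqa, map_zero]

/-- On a domain of transcendence degree one with a nonconstant invariant rational function, an
algebraic family containing the identity is trivial. -/
theorem IsAlgebraicFamily.eq_one [Infinite k] (htr : Algebra.trdeg k A ≤ 1)
    (H : Subgroup (A ≃ₐ[k] A))
    {x : FractionRing A} (hx : Transcendental k x)
    (hxH : ∀ h ∈ H, IsFractionRing.fieldEquivOfAlgEquivHom k (FractionRing A) h x = x)
    {S : Set (A ≃ₐ[k] A)} (hS : IsAlgebraicFamily S) (hSH : S ⊆ H) (h1 : 1 ∈ S)
    {h : A ≃ₐ[k] A} (hh : h ∈ S) : h = 1 := by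
  obtain ⟨n, _, Ψ, g, rfl, hΨ⟩ := hS
  obtain ⟨z₀, hz₀⟩ := h1
  obtain ⟨z, rfl⟩ := hh
  ext a
  have hfin := finite_orbit_of_transcendental htr H hx hxH a
  -- Since `Ψ a` takes finitely many values on `kⁿ`, it is constant.
  have hprod : ∏ c ∈ hfin.toFinset, (Ψ a - MvPolynomial.C c) = 0 := by
    refine MvPolynomial.funext_set (fun _ => Set.range (algebraMap k A)) (fun _ =>
      Set.infinite_range_of_injective (FaithfulSMul.algebraMap_injective k A)) fun y hy => ?_
    choose w hw using fun i => hy i trivial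
    obtain rfl : (fun i => algebraMap k A (w i)) = y := funext hw
    rw [map_zero, map_prod]
    refine Finset.prod_eq_zero (i := g w a) ?_ ?_
    · simpa using ⟨g w, hSH ⟨w, rfl⟩, rfl⟩
    · simp [hΨ]
  obtain ⟨c, -, hc⟩ := Finset.prod_eq_zero_iff.1 hprod
  have hΨa : Ψ a = MvPolynomial.C c := sub_eq_zero.1 hc
  have h1 : g z₀ a = c := by rw [hΨ, hΨa, MvPolynomial.eval_C]
  rw [hz₀] at h1
  rw [hΨ, hΨa, MvPolynomial.eval_C, ← h1]

end DimensionOne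

/-! ### Comorphisms of automorphisms of an affine variety -/

section Comorphisms

variable {X : Scheme.{0}} [X.Over SpecC]

/-- The ring of global functions of a `ℂ`-scheme is a `ℂ`-algebra. -/
noncomputable instance globalFunctionsAlgebra : Algebra ℂ Γ(X, ⊤) :=
  ((Scheme.ΓSpecIso (CommRingCat.of ℂ)).inv ≫ (X ↘ SpecC).appTop).hom.toAlgebra

theorem appTop_algebraMap {Y : Scheme.{0}} {f g : Y ⟶ X}
    (h : f ≫ (X ↘ SpecC) = g ≫ (X ↘ SpecC)) (z : ℂ) :
    f.appTop (algebraMap ℂ Γ(X, ⊤) z) = g.appTop (algebraMap ℂ Γ(X, ⊤) z) := by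
  have := congrArg Scheme.Hom.appTop h
  rw [Scheme.Hom.comp_appTop, Scheme.Hom.comp_appTop] at this
  exact congrArg (fun f : Γ(SpecC, ⊤) ⟶ Γ(Y, ⊤) =>
    f ((Scheme.ΓSpecIso (CommRingCat.of ℂ)).inv z)) this

/-- The automorphism `f ↦ f ∘ g` of the algebra of global functions. -/
noncomputable def comorphism (g : Aut X) (hg : g.hom ≫ (X ↘ SpecC) = (X ↘ SpecC)) :
    Γ(X, ⊤) ≃ₐ[ℂ] Γ(X, ⊤) :=
  AlgEquiv.ofBijective
    { g.hom.appTop.hom with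
      commutes' := fun z => by
        have := appTop_algebraMap (f := g.hom) (g := 𝟙 X) (by rw [hg, Category.id_comp]) z
        rw [Scheme.Hom.id_appTop] at this
        exact this }
    (haveI : IsIso g.hom := Iso.isIso_hom g
    ConcreteCategory.bijective_of_isIso (g.hom.app ⊤))

/-- The group of comorphisms `f ↦ f ∘ g` of the elements of a group `G` of automorphisms of `X`. -/
def comorphismGroup (G : Subgroup (Aut X)) : Subgroup (Γ(X, ⊤) ≃ₐ[ℂ] Γ(X, ⊤)) where
  carrier := {h | ∃ g ∈ G, ∀ a, h a = g.hom.appTop a}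
  one_mem' := ⟨1, G.one_mem, fun a => by
    change a = (𝟙 X : X ⟶ X).appTop a
    rw [Scheme.Hom.id_appTop]; rfl⟩
  mul_mem' := by
    rintro h₁ h₂ ⟨g₁, hg₁, H₁⟩ ⟨g₂, hg₂, H₂⟩
    refine ⟨g₂ * g₁, G.mul_mem hg₂ hg₁, fun a => ?_⟩
    change h₁ (h₂ a) = (g₁.hom ≫ g₂.hom).appTop a
    rw [Scheme.Hom.comp_appTop, H₂, H₁]; rfl
  inv_mem' := by
    rintro h ⟨g, hg, H⟩
    refine ⟨g⁻¹, G.inv_mem hg, fun a => ?_⟩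
    apply h.injective
    change h (h.symm a) = _
    rw [AlgEquiv.apply_symm_apply, H]
    change a = g.hom.appTop (g.inv.appTop a)
    have : g.inv.appTop ≫ g.hom.appTop = 𝟙 _ := by
      rw [← Scheme.Hom.comp_appTop, g.hom_inv_id, Scheme.Hom.id_appTop]
    exact (congrArg (fun f : Γ(X, ⊤) ⟶ Γ(X, ⊤) => f a) this).symm

end Comorphisms

/-! ### Flows of algebraic actions -/

section Flows

variable {X : Scheme.{0}} [X.Over SpecC]

theorem AlgCAction.flow_over (φ : AlgCAction X) (z : ℂ) :
    (φ.flow z).hom ≫ (X ↘ SpecC) = (X ↘ SpecC) := by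
  change (sliceAt X z ≫ φ.hom) ≫ _ = _
  rw [Category.assoc, φ.hom_over, sliceAt, AffineSpace.homOfVector_over_assoc, Category.id_comp]

theorem AlgCAction.flow_add (φ : AlgCAction X) (z w : ℂ) :
    φ.flow (z + w) = φ.flow z * φ.flow w :=
  Iso.ext (φ.slice_add z w)

theorem AlgCAction.flow_zero (φ : AlgCAction X) : φ.flow 0 = 1 := by
  have := φ.flow_add 0 0
  rwa [add_zero, left_eq_mul] at this

theorem AlgCAction.flow_neg (φ : AlgCAction X) (z : ℂ) : φ.flow (-z) = (φ.flow z)⁻¹ := by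
  rw [eq_inv_iff_mul_eq_one, ← φ.flow_add, neg_add_cancel, φ.flow_zero]

theorem generatedGroup_over {ι : Type} (φ : ι → AlgCAction X) {g : Aut X}
    (hg : g ∈ generatedGroup φ) : g.hom ≫ (X ↘ SpecC) = (X ↘ SpecC) := by
  induction hg using Subgroup.closure_induction with
  | mem g hg =>
    obtain ⟨⟨i, z⟩, rfl⟩ := hg
    exact (φ i).flow_over z
  | one => exact Category.id_comp _
  | mul g g' _ _ h h' =>
    change (g'.hom ≫ g.hom) ≫ _ = _
    rw [Category.assoc, h, h']
  | inv g _ h =>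
    exact (Iso.inv_comp_eq _).2 h.symm

/-- On an affine `X`, the morphism `ℂ × X ⟶ X` of an action is given by a homomorphism from the
algebra of functions to the polynomial ring in one variable over it. -/
theorem AlgCAction.exists_coaction [IsAffine X] (φ : AlgCAction X) :
    ∃ Φ : Γ(X, ⊤) →ₐ[ℂ] MvPolynomial PUnit.{1} Γ(X, ⊤), ∀ z a,
      (φ.flow z).hom.appTop a = MvPolynomial.eval (fun _ => algebraMap ℂ Γ(X, ⊤) z) (Φ a) := by
  let A := Γ(X, ⊤)
  -- Since `X` is affine, `Γ(𝔸¹ × X)` is the polynomial ring over `Γ(X)`.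
  let E₀ : MvPolynomial PUnit.{1} A →+* Γ(𝔸(PUnit.{1}; X), ⊤) :=
    MvPolynomial.eval₂Hom (𝔸(PUnit.{1}; X) ↘ X).appTop.hom (AffineSpace.coord X)
  have hE₀ : Function.Bijective E₀ := by
    have h := AffineSpace.isoOfIsAffine_hom_appTop (n := PUnit.{1}) (S := X)
    rw [← Iso.inv_comp_eq] at h
    have : IsIso (CommRingCat.ofHom E₀) := by
      rw [← h]
      have : IsIso (AffineSpace.isoOfIsAffine PUnit.{1} X).hom.appTop :=
        inferInstanceAs (IsIso ((AffineSpace.isoOfIsAffine PUnit.{1} X).hom.app ⊤))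
      exact IsIso.comp_isIso
    exact ConcreteCategory.bijective_of_isIso (CommRingCat.ofHom E₀)
  let E : MvPolynomial PUnit.{1} A ≃+* Γ(𝔸(PUnit.{1}; X), ⊤) := RingEquiv.ofBijective E₀ hE₀
  have hEC (a : A) : E (MvPolynomial.C a) = (𝔸(PUnit.{1}; X) ↘ X).appTop a :=
    MvPolynomial.eval₂_C _ _ _
  refine ⟨{ E.symm.toRingHom.comp φ.hom.appTop.hom with commutes' := fun c => ?_ }, fun z a => ?_⟩
  · change E.symm (φ.hom.appTop (algebraMap ℂ A c)) = MvPolynomial.C (algebraMap ℂ A c)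
    rw [RingEquiv.symm_apply_eq, hEC]
    exact appTop_algebraMap φ.hom_over c
  · change (sliceAt X z ≫ φ.hom).appTop a = MvPolynomial.eval _ (E.symm (φ.hom.appTop a))
    rw [Scheme.Hom.comp_appTop]
    change (sliceAt X z).appTop (φ.hom.appTop a) = _
    generalize φ.hom.appTop a = b
    obtain ⟨p, rfl⟩ := E.surjective b
    rw [RingEquiv.symm_apply_apply]
    suffices H : (sliceAt X z).appTop.hom.comp (E : MvPolynomial PUnit.{1} A →+* _) =
        MvPolynomial.eval fun _ => algebraMap ℂ A z from
      congrArg (fun f : MvPolynomial PUnit.{1} A →+* A => f p) H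
    apply MvPolynomial.ringHom_ext
    · intro a
      rw [MvPolynomial.eval_C]
      change (sliceAt X z).appTop (E (MvPolynomial.C a)) = a
      rw [hEC]
      have : (𝔸(PUnit.{1}; X) ↘ X).appTop ≫ (sliceAt X z).appTop = 𝟙 _ := by
        rw [← Scheme.Hom.comp_appTop, sliceAt, AffineSpace.homOfVector_over, Scheme.Hom.id_appTop]
      exact congrArg (fun f : Γ(X, ⊤) ⟶ Γ(X, ⊤) => f a) this
    · intro i
      rw [MvPolynomial.eval_X]
      change (sliceAt X z).appTop (E (MvPolynomial.X i)) = _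
      have : E (MvPolynomial.X i) = AffineSpace.coord X i := MvPolynomial.eval₂_X _ _ _
      rw [this]
      exact AffineSpace.homOfVector_appTop_coord _ _ _

/-- The flow of an action is an algebraic family with one parameter. -/
theorem AlgCAction.isAlgebraicFamily [IsAffine X] (φ : AlgCAction X) :
    IsAlgebraicFamily (Set.range fun z : ℂ => comorphism (φ.flow z) (φ.flow_over z)) := by
  obtain ⟨Φ, hΦ⟩ := φ.exists_coaction
  refine ⟨PUnit, inferInstance, Φ,
    fun z => comorphism (φ.flow (z PUnit.unit)) (φ.flow_over (z PUnit.unit)), ?_, fun z a => ?_⟩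
  · ext h
    exact ⟨fun ⟨z, hz⟩ => ⟨fun _ => z, hz⟩, fun ⟨z, hz⟩ => ⟨_, hz⟩⟩
  · exact hΦ _ _

open scoped Pointwise in
/-- Every element of the generated group lies in an algebraic family contained in it: a product of
flows can be deformed by varying the times. -/
theorem exists_isAlgebraicFamily_of_mem_generatedGroup [IsAffine X] {ι : Type}
    (φ : ι → AlgCAction X) {g : Aut X} (hg : g ∈ generatedGroup φ) :
    ∃ S : Set (Γ(X, ⊤) ≃ₐ[ℂ] Γ(X, ⊤)), IsAlgebraicFamily S ∧
      S ⊆ comorphismGroup (generatedGroup φ) ∧ 1 ∈ S ∧ ∃ h ∈ S, ∀ a, h a = g.hom.appTop a := by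
  have hflow (i : ι) (z : ℂ) : (φ i).flow z ∈ generatedGroup φ :=
    Subgroup.subset_closure ⟨(i, z), rfl⟩
  -- The inverse of a flow is the flow at the opposite time, so inverses need no separate treatment.
  have hgen (i : ι) (z : ℂ) : ∃ S : Set (Γ(X, ⊤) ≃ₐ[ℂ] Γ(X, ⊤)), IsAlgebraicFamily S ∧
      S ⊆ comorphismGroup (generatedGroup φ) ∧ 1 ∈ S ∧
      ∃ h ∈ S, ∀ a, h a = ((φ i).flow z).hom.appTop a := by
    refine ⟨_, (φ i).isAlgebraicFamily, ?_, ⟨0, ?_⟩, _, ⟨z, rfl⟩, fun a => rfl⟩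
    · rintro _ ⟨w, rfl⟩
      exact ⟨_, hflow i w, fun a => rfl⟩
    · ext a
      change ((φ i).flow 0).hom.appTop a = a
      rw [(φ i).flow_zero]
      change (𝟙 X : X ⟶ X).appTop a = a
      rw [Scheme.Hom.id_appTop]; rfl
  refine Subgroup.closure_induction'' (p := fun g _ => ∃ S : Set (Γ(X, ⊤) ≃ₐ[ℂ] Γ(X, ⊤)),
    IsAlgebraicFamily S ∧ S ⊆ comorphismGroup (generatedGroup φ) ∧ 1 ∈ S ∧
      ∃ h ∈ S, ∀ a, h a = g.hom.appTop a) ?_ ?_ ?_ ?_ hg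
  · rintro _ ⟨⟨i, z⟩, rfl⟩
    exact hgen i z
  · rintro _ ⟨⟨i, z⟩, rfl⟩
    rw [← AlgCAction.flow_neg]
    exact hgen i (-z)
  · refine ⟨{1}, isAlgebraicFamily_one, ?_, rfl, 1, rfl, fun a => ?_⟩
    · rintro _ rfl
      exact Subgroup.one_mem _
    · change a = (𝟙 X : X ⟶ X).appTop a
      rw [Scheme.Hom.id_appTop]; rfl
  · rintro x y - - ⟨S, hS, hSH, h1S, h, hh, H⟩ ⟨T, hT, hTH, h1T, h', hh', H'⟩
    refine ⟨T * S, hT.mul hS, ?_, ⟨1, h1T, 1, h1S, mul_one 1⟩, h' * h, ⟨h', hh', h, hh, rfl⟩,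
      fun a => ?_⟩
    · rintro _ ⟨t, ht, s, hs, rfl⟩
      exact Subgroup.mul_mem _ (hTH ht) (hSH hs)
    · change h' (h a) = (y.hom ≫ x.hom).appTop a
      rw [Scheme.Hom.comp_appTop, H, H']; rfl

/-- `exists_isAlgebraicFamily_of_mem_generatedGroup` for the group of comorphisms. -/
theorem exists_isAlgebraicFamily_of_mem_comorphismGroup [IsAffine X] {ι : Type}
    (φ : ι → AlgCAction X) {h : Γ(X, ⊤) ≃ₐ[ℂ] Γ(X, ⊤)}
    (hh : h ∈ comorphismGroup (generatedGroup φ)) :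
    ∃ S : Set (Γ(X, ⊤) ≃ₐ[ℂ] Γ(X, ⊤)), IsAlgebraicFamily S ∧
      S ⊆ comorphismGroup (generatedGroup φ) ∧ 1 ∈ S ∧ h ∈ S := by
  obtain ⟨g, hg, H⟩ := hh
  obtain ⟨S, hS, hSH, h1S, h', hh', H'⟩ := exists_isAlgebraicFamily_of_mem_generatedGroup φ hg
  have : h = h' := AlgEquiv.ext fun a => by rw [H, H']
  exact ⟨S, hS, hSH, h1S, this ▸ hh'⟩

end Flows

/-! ### Closed points -/

section ClosedPoints

variable {X : Scheme.{0}} [IsAffine X]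

theorem mem_isoSpec_asIdeal_iff (x : X) (f : Γ(X, ⊤)) :
    f ∈ (X.isoSpec.hom x).asIdeal ↔ x ∉ X.basicOpen f := by
  rw [← Scheme.toSpecΓ_preimage_basicOpen]
  change _ ↔ ¬ (f ∉ _)
  rw [not_not]; rfl

/-- A point of an affine scheme is determined by the functions vanishing at it. -/
theorem eq_of_forall_mem_basicOpen_iff {x y : X}
    (h : ∀ f : Γ(X, ⊤), x ∈ X.basicOpen f ↔ y ∈ X.basicOpen f) : x = y := by
  apply X.isoSpec.hom.homeomorph.injective
  refine PrimeSpectrum.ext (Ideal.ext fun f => ?_)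
  exact (mem_isoSpec_asIdeal_iff x f).trans
    ((not_congr (h f)).trans (mem_isoSpec_asIdeal_iff y f).symm)

variable [X.Over SpecC] [LocallyOfFiniteType (X ↘ SpecC)]

instance globalFunctions_finiteType : Algebra.FiniteType ℂ Γ(X, ⊤) := by
  have h : (X ↘ SpecC).appTop.hom.FiniteType :=
    (HasRingHomProperty.iff_of_isAffine (P := @LocallyOfFiniteType)).1 inferInstance
  rw [← RingHom.finiteType_algebraMap]
  refine RingHom.FiniteType.comp h (RingHom.FiniteType.of_surjective _ ?_)
  exact (ConcreteCategory.bijective_of_isIso (Scheme.ΓSpecIso (CommRingCat.of ℂ)).inv).2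

/-- Closed points of an affine variety are evaluations of functions. -/
theorem exists_algHom_of_mem_closedPoints {x : X} (hx : x ∈ closedPoints X) :
    ∃ χ : Γ(X, ⊤) →ₐ[ℂ] ℂ, ∀ f, x ∈ X.basicOpen f ↔ χ f ≠ 0 := by
  have hmax : (X.isoSpec.hom x).asIdeal.IsMaximal := by
    refine (PrimeSpectrum.isClosed_singleton_iff_isMaximal _).1 ?_
    have := X.isoSpec.hom.homeomorph.isClosedMap _ (mem_closedPoints_iff.1 hx)
    rwa [Set.image_singleton] at this
  obtain ⟨χ, hχ⟩ := exists_algHom_ker_eq (k := ℂ) (X.isoSpec.hom x).asIdeal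
  refine ⟨χ, fun f => ?_⟩
  have h := mem_isoSpec_asIdeal_iff x f
  rw [← hχ, RingHom.mem_ker] at h
  exact (not_iff_comm.1 h.symm).symm.trans (Iff.rfl)

end ClosedPoints

/-! ### Existence of invariant rational functions -/

section InvariantFunctions

variable {X : Scheme.{0}} [X.Over SpecC] [IsAffine X] [AlgebraicGeometry.IsIntegral X]
  [LocallyOfFiniteType (X ↘ SpecC)]

/-- If general orbits contain no nonempty open set, then there is a nonconstant invariant rational
function. -/
theorem exists_transcendental_invariant {ι : Type} (φ : ι → AlgCAction X)
    (horbit : ForGeneralPoint X fun x => ¬ ContainsOpenSubset (autOrbit (generatedGroup φ) x)) :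
    ∃ x : FractionRing Γ(X, ⊤), Transcendental ℂ x ∧
      ∀ h ∈ comorphismGroup (generatedGroup φ),
        IsFractionRing.fieldEquivOfAlgEquivHom ℂ (FractionRing Γ(X, ⊤)) h x = x := by
  by_contra! hcon
  have hH : ∀ x : FractionRing Γ(X, ⊤), (∀ h ∈ comorphismGroup (generatedGroup φ),
        IsFractionRing.fieldEquivOfAlgEquivHom ℂ (FractionRing Γ(X, ⊤)) h x = x) →
      x ∈ Set.range (algebraMap ℂ (FractionRing Γ(X, ⊤))) := by
    intro x hx
    have hint : _root_.IsIntegral ℂ x := by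
      rw [← isAlgebraic_iff_isIntegral]
      by_contra ht
      obtain ⟨h, hh, hne⟩ := hcon x ht
      exact hne (hx h hh)
    exact minpoly.mem_range_of_degree_eq_one ℂ x
      (IsAlgClosed.degree_eq_one_of_irreducible ℂ (minpoly.irreducible hint))
  obtain ⟨a, ha, key⟩ := exists_open_orbit (comorphismGroup (generatedGroup φ))
    (fun h hh => exists_isAlgebraicFamily_of_mem_comorphismGroup φ hh) hH
  obtain ⟨U, hU, hUo⟩ := horbit
  have : JacobsonSpace X := LocallyOfFiniteType.jacobsonSpace (X ↘ SpecC)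
  have hbasic {f : Γ(X, ⊤)} (hf : f ≠ 0) : (X.basicOpen f : Set X).Nonempty := by
    rw [← TopologicalSpace.Opens.ne_bot_iff_nonempty]
    exact fun h => hf ((basicOpen_eq_bot_iff f).1 h)
  obtain ⟨x, ⟨hxU, hxa⟩, hx⟩ := nonempty_inter_closedPoints
    (nonempty_preirreducible_inter U.2 (X.basicOpen a).2 hU (hbasic ha))
    (U.2.inter (X.basicOpen a).2).isLocallyClosed
  obtain ⟨χ, hχ⟩ := exists_algHom_of_mem_closedPoints hx
  obtain ⟨f, hf, hfo⟩ := key χ ((hχ a).1 hxa)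
  refine hUo x ⟨hxU, hx⟩ ⟨X.basicOpen f, hbasic hf, ?_⟩
  rintro y ⟨hyf, hy⟩
  obtain ⟨ψ, hψ⟩ := exists_algHom_of_mem_closedPoints hy
  obtain ⟨h, ⟨g, hg, H⟩, rfl⟩ := hfo ψ ((hψ f).1 hyf)
  refine ⟨g, hg, eq_of_forall_mem_basicOpen_iff fun b => ?_⟩
  rw [hψ, AlgHom.comp_apply]
  change x ∈ g.hom ⁻¹ᵁ X.basicOpen b ↔ χ (h b) ≠ 0
  rw [Scheme.preimage_basicOpen_top, hχ, H]

end InvariantFunctions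

/-! ### The rational map defined by a fraction -/

section Quotients

variable {X : Scheme.{0}} [IsAffine X]

/-- Functions on `D(b)` are elements of the fraction field. -/
theorem exists_ringHom_fractionRing [AlgebraicGeometry.IsIntegral X] {b : Γ(X, ⊤)} (hb : b ≠ 0) :
    ∃ L : Γ((X.basicOpen b).toScheme, ⊤) →+* FractionRing Γ(X, ⊤),
      ∀ c, L ((X.basicOpen b).ι.appTop c) = algebraMap Γ(X, ⊤) (FractionRing Γ(X, ⊤)) c := by
  have hu : IsUnit (algebraMap Γ(X, ⊤) (FractionRing Γ(X, ⊤)) b) :=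
    isUnit_iff_ne_zero.2 ((map_ne_zero_iff _ (IsFractionRing.injective _ _)).2 hb)
  refine ⟨(IsLocalization.Away.lift (S := Γ(X, X.basicOpen b)) b hu).comp
    (X.basicOpen b).topIso.hom.hom, fun c => ?_⟩
  have h : (X.basicOpen b).ι.appTop ≫ (X.basicOpen b).topIso.hom =
      X.presheaf.map (homOfLE le_top).op := by
    exact (X.presheaf.map_comp _ _).symm.trans (congrArg _ (Subsingleton.elim _ _))
  have h' : (X.basicOpen b).topIso.hom ((X.basicOpen b).ι.appTop c) =
      algebraMap Γ(X, ⊤) Γ(X, X.basicOpen b) c :=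
    congrArg (fun f : Γ(X, ⊤) ⟶ Γ(X, X.basicOpen b) => f c) h
  rw [RingHom.comp_apply]
  exact (congrArg _ h').trans (IsLocalization.Away.lift_eq b hu c)

/-- The function `s = a / b` on `D(b)`, given by the equation `s b = a`. -/
theorem exists_mul_eq_on_basicOpen (X : Scheme.{0}) (a b : Γ(X, ⊤)) :
    ∃ s : Γ((X.basicOpen b).toScheme, ⊤),
      s * (X.basicOpen b).ι.appTop b = (X.basicOpen b).ι.appTop a := by
  have hu : IsUnit ((X.basicOpen b).ι.appTop b) := by
    have h := RingedSpace.isUnit_res_basicOpen X.toRingedSpace b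
    have : (X.basicOpen b).topIso.inv ((X.presheaf.map (homOfLE le_top).op) b) =
      (X.basicOpen b).ι.appTop b := by
      rw [Scheme.Opens.ι_appTop]
      have : X.presheaf.map (homOfLE (le_top : X.basicOpen b ≤ ⊤)).op ≫
        (X.basicOpen b).topIso.inv = X.presheaf.map (homOfLE le_top).op := by
        exact (X.presheaf.map_comp _ _).symm.trans (congrArg _ (Subsingleton.elim _ _))
      exact congrArg (fun f : Γ(X, ⊤) ⟶ _ => f b) this
    rw [← this]
    exact h.map (X.basicOpen b).topIso.inv.hom
  obtain ⟨u, hu⟩ := hu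
  exact ⟨(X.basicOpen b).ι.appTop a * (u⁻¹ : _), by rw [← hu, mul_assoc, Units.inv_mul, mul_one]⟩

end Quotients

section FractionMap

variable {X : Scheme.{0}} [X.Over SpecC] [AlgebraicGeometry.IsIntegral X]

/-- The partial map `s : X ⇢ 𝔸¹` defined by a function `s` on `D(b)`. -/
noncomputable def partialMapOfFunction {b : Γ(X, ⊤)} (hb : b ≠ 0)
    (s : Γ((X.basicOpen b).toScheme, ⊤)) : X.PartialMap 𝔸(PUnit.{1}; SpecC) where
  domain := X.basicOpen b
  dense_domain := (X.basicOpen b).2.dense <|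
    (TopologicalSpace.Opens.ne_bot_iff_nonempty _).1 fun h => hb ((basicOpen_eq_bot_iff b).1 h)
  hom := AffineSpace.homOfVector ((X.basicOpen b).toScheme ↘ SpecC) fun _ => s

instance {b : Γ(X, ⊤)} (hb : b ≠ 0) (s : Γ((X.basicOpen b).toScheme, ⊤)) :
    (partialMapOfFunction hb s).IsOver SpecC :=
  inferInstanceAs ((AffineSpace.homOfVector ((X.basicOpen b).toScheme ↘ SpecC) _).IsOver SpecC)

/-- The rational map to the affine line defined by a nonconstant fraction is dominant. -/
theorem isDominant_partialMapOfFunction [IsAffine X] {a b : Γ(X, ⊤)} (hb : b ≠ 0)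
    {s : Γ((X.basicOpen b).toScheme, ⊤)}
    (hs : s * (X.basicOpen b).ι.appTop b = (X.basicOpen b).ι.appTop a)
    {x : FractionRing Γ(X, ⊤)} (hx : Transcendental ℂ x)
    (hxab : x * algebraMap _ _ b = algebraMap _ _ a) :
    IsDominant (partialMapOfFunction hb s).hom := by
  let U := X.basicOpen b
  let K := FractionRing Γ(X, ⊤)
  let f : U.toScheme ⟶ 𝔸(PUnit.{1}; SpecC) := (partialMapOfFunction hb s).hom
  obtain ⟨L, hL⟩ := exists_ringHom_fractionRing hb
  have hbK : algebraMap Γ(X, ⊤) K b ≠ 0 := (map_ne_zero_iff _ (IsFractionRing.injective _ _)).2 hb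
  have hLs : L s = x := by
    apply mul_right_cancel₀ hbK
    rw [hxab, ← hL, ← hL, ← map_mul, hs]
  -- After identifying `Γ(𝔸¹)` with `ℂ[t]`, the comorphism followed by `L` is evaluation at `x`.
  let E : MvPolynomial PUnit.{1} ℂ →+* Γ(𝔸(PUnit.{1}; SpecC), ⊤) :=
    MvPolynomial.eval₂Hom ((Scheme.ΓSpecIso (CommRingCat.of ℂ)).inv ≫
        (𝔸(PUnit.{1}; SpecC) ↘ SpecC).appTop).hom (AffineSpace.coord SpecC)
  have hE : Function.Bijective E := by
    have h := AffineSpace.SpecIso_hom_appTop (n := PUnit.{1}) (CommRingCat.of ℂ)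
    rw [← Iso.inv_comp_eq] at h
    have : IsIso (CommRingCat.ofHom E) := by
      rw [← h]
      have : IsIso (AffineSpace.SpecIso PUnit.{1} (CommRingCat.of ℂ)).hom.appTop :=
        inferInstanceAs (IsIso ((AffineSpace.SpecIso PUnit.{1} (CommRingCat.of ℂ)).hom.app ⊤))
      exact IsIso.comp_isIso
    exact ConcreteCategory.bijective_of_isIso (CommRingCat.ofHom E)
  have hcomp : (L.comp f.appTop.hom).comp E =
      (MvPolynomial.aeval (fun _ => x) : MvPolynomial PUnit.{1} ℂ →ₐ[ℂ] K).toRingHom := by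
    apply MvPolynomial.ringHom_ext
    · intro c
      have h1 : E (MvPolynomial.C c) = (𝔸(PUnit.{1}; SpecC) ↘ SpecC).appTop
          ((Scheme.ΓSpecIso (CommRingCat.of ℂ)).inv c) := MvPolynomial.eval₂_C _ _ _
      have h2 : (𝔸(PUnit.{1}; SpecC) ↘ SpecC).appTop ≫ f.appTop =
          (X ↘ SpecC).appTop ≫ U.ι.appTop := by
        rw [← Scheme.Hom.comp_appTop, ← Scheme.Hom.comp_appTop]
        congr 1
        exact AffineSpace.homOfVector_over _ _
      have h3 : f.appTop ((𝔸(PUnit.{1}; SpecC) ↘ SpecC).appTop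
          ((Scheme.ΓSpecIso (CommRingCat.of ℂ)).inv c)) = U.ι.appTop (algebraMap ℂ Γ(X, ⊤) c) :=
        congrArg (fun g : Γ(SpecC, ⊤) ⟶ Γ(U.toScheme, ⊤) =>
          g ((Scheme.ΓSpecIso (CommRingCat.of ℂ)).inv c)) h2
      change L (f.appTop (E (MvPolynomial.C c))) = MvPolynomial.aeval _ (MvPolynomial.C c)
      rw [h1, h3, hL, MvPolynomial.aeval_C, ← IsScalarTower.algebraMap_apply]
    · intro i
      have h1 : E (MvPolynomial.X i) = AffineSpace.coord SpecC i := MvPolynomial.eval₂_X _ _ _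
      have h2 : f.appTop (AffineSpace.coord SpecC i) = s :=
        AffineSpace.homOfVector_appTop_coord _ _ _
      change L (f.appTop (E (MvPolynomial.X i))) = MvPolynomial.aeval _ (MvPolynomial.X i)
      rw [h1, h2, hLs, MvPolynomial.aeval_X]
  have hinj : Function.Injective f.appTop := by
    have halg : AlgebraicIndependent ℂ (fun _ : PUnit.{1} => x) :=
      algebraicIndependent_unique_type_iff.2 hx
    have h : Function.Injective ((L.comp f.appTop.hom).comp E) := by
      rw [hcomp]
      exact halg
    intro y z hyz
    obtain ⟨p, rfl⟩ := hE.surjective y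
    obtain ⟨q, rfl⟩ := hE.surjective z
    exact congrArg E (h (congrArg L hyz))
  have : CompactSpace (partialMapOfFunction hb s).domain.toScheme :=
    isCompact_iff_compactSpace.1 ((isAffineOpen_top X).basicOpen b).isCompact
  exact isDominant_of_of_appTop_injective hinj

/-- The restriction of a morphism `f` to the preimage of `V`, as it occurs in the composition of
partial maps, is the restriction of `f`. -/
theorem toPartialMap_restrict_ι {X Y : Scheme.{0}} (f : X ⟶ Y) (V : Y.Opens) :
    ((f.toPartialMap.domain.ι.isoImage (f.toPartialMap.hom ⁻¹ᵁ V)).inv ≫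
      f.toPartialMap.hom ∣_ V) ≫ V.ι =
      (f.toPartialMap.domain.ι ''ᵁ f.toPartialMap.hom ⁻¹ᵁ V).ι ≫ f := by
  rw [Category.assoc, morphismRestrict_ι]
  exact Scheme.Hom.isoImage_inv_ι_assoc f.toPartialMap.domain.ι _ f

/-- The rational map defined by an invariant fraction `a / b` is invariant. -/
theorem toRationalMap_comp_partialMapOfFunction {a b : Γ(X, ⊤)} (hb : b ≠ 0)
    {s : Γ((X.basicOpen b).toScheme, ⊤)}
    (hs : s * (X.basicOpen b).ι.appTop b = (X.basicOpen b).ι.appTop a) (g : Aut X)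
    (hg : g.hom ≫ (X ↘ SpecC) = (X ↘ SpecC))
    (hab : g.hom.appTop a * b = a * g.hom.appTop b) :
    (Scheme.Hom.toRationalMap g.hom).comp (partialMapOfFunction hb s).toRationalMap =
      (partialMapOfFunction hb s).toRationalMap := by
  have hdom : IsDominant g.hom.toPartialMap.hom :=
    (Scheme.PartialMap.isDominant_toRationalMap_iff _).1 inferInstance
  rw [Scheme.RationalMap.toRationalMap_comp, Scheme.PartialMap.toRationalMap_eq_iff]
  let π := partialMapOfFunction hb s
  let ρ := g.hom.toPartialMap.comp π
  let W : X.Opens := ρ.domain ⊓ π.domain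
  have hW : Dense (W : Set X) :=
    ρ.dense_domain.inter_of_isOpen_left π.dense_domain ρ.domain.2
  refine ⟨W, hW, inf_le_left, inf_le_right, ?_⟩
  let U := X.basicOpen b
  let j₁ : W.toScheme ⟶ U.toScheme := X.homOfLE inf_le_left ≫
    (g.hom.toPartialMap.domain.ι.isoImage _).inv ≫ g.hom.toPartialMap.hom ∣_ U
  let j₂ : W.toScheme ⟶ U.toScheme := X.homOfLE inf_le_right
  have hj₁ : j₁ ≫ U.ι = W.ι ≫ g.hom := by
    exact (Category.assoc _ _ _).trans ((congrArg (X.homOfLE inf_le_left ≫ ·)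
      (toPartialMap_restrict_ι g.hom U)).trans (X.homOfLE_ι_assoc _ _))
  have hj₂ : j₂ ≫ U.ι = W.ι := X.homOfLE_ι _
  change _ = j₂ ≫ AffineSpace.homOfVector (U.toScheme ↘ SpecC) fun _ => s
  have : (ρ.restrict W hW inf_le_left).hom =
      j₁ ≫ AffineSpace.homOfVector (U.toScheme ↘ SpecC) fun _ => s := by
    simp only [Scheme.PartialMap.restrict_hom, j₁, Category.assoc]
    rfl
  refine this.trans ?_
  rw [AffineSpace.comp_homOfVector, AffineSpace.comp_homOfVector]
  have hover : j₁ ≫ (U.toScheme ↘ SpecC) = j₂ ≫ (U.toScheme ↘ SpecC) := by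
    change j₁ ≫ U.ι ≫ (X ↘ SpecC) = j₂ ≫ U.ι ≫ (X ↘ SpecC)
    rw [reassoc_of% hj₁, reassoc_of% hj₂, hg]
  have hne : Nonempty W := hW.nonempty.to_subtype
  have hinj : Function.Injective W.ι.appTop := by
    have : Nonempty (W.ι ''ᵁ ⊤ : X.Opens) := by
      rw [Scheme.Opens.ι_image_top]
      exact hne
    exact map_injective_of_isIntegral X (homOfLE (x := W.ι ''ᵁ ⊤) le_top)
  have e₁ (c : Γ(X, ⊤)) : j₁.appTop (U.ι.appTop c) = W.ι.appTop (g.hom.appTop c) := by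
    have := congrArg Scheme.Hom.appTop hj₁
    rw [Scheme.Hom.comp_appTop, Scheme.Hom.comp_appTop] at this
    exact congrArg (fun f : Γ(X, ⊤) ⟶ Γ(W.toScheme, ⊤) => f c) this
  have e₂ (c : Γ(X, ⊤)) : j₂.appTop (U.ι.appTop c) = W.ι.appTop c := by
    have := congrArg Scheme.Hom.appTop hj₂
    rw [Scheme.Hom.comp_appTop] at this
    exact congrArg (fun f : Γ(X, ⊤) ⟶ Γ(W.toScheme, ⊤) => f c) this
  have hgb : g.hom.appTop b ≠ 0 := by
    have hi : IsIso g.hom := Iso.isIso_hom g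
    exact (map_ne_zero_iff _ (ConcreteCategory.bijective_of_isIso (g.hom.app ⊤)).1).2 hb
  have hs₁ := congrArg j₁.appTop hs
  have hs₂ := congrArg j₂.appTop hs
  rw [map_mul, e₁, e₁] at hs₁
  rw [map_mul, e₂, e₂] at hs₂
  -- Both coordinates equal `a / b`: multiply by `b · g^*(b)` and use the invariance of `a / b`.
  have hss : j₁.appTop s = j₂.appTop s := by
    apply mul_right_cancel₀ ((map_ne_zero_iff _ hinj).2 hgb)
    apply mul_right_cancel₀ ((map_ne_zero_iff _ hinj).2 hb)
    rw [hs₁, ← map_mul, hab, mul_right_comm, hs₂, map_mul]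
  rw [hover]
  congr 1
  funext _
  exact hss

end FractionMap

/-! ### Dimensions and the proof -/

section Dimensions

theorem topologicalKrullDim_eq_of_isAffine (X : Scheme.{0}) [IsAffine X] :
    topologicalKrullDim X = ringKrullDim Γ(X, ⊤) := by
  rw [← PrimeSpectrum.topologicalKrullDim_eq_ringKrullDim]
  exact IsHomeomorph.topologicalKrullDim_eq _ X.isoSpec.hom.homeomorph.isHomeomorph

theorem topologicalKrullDim_affineLine : topologicalKrullDim 𝔸(PUnit.{1}; SpecC) = 1 := by
  rw [IsHomeomorph.topologicalKrullDim_eq _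
    (AffineSpace.SpecIso PUnit.{1} (CommRingCat.of ℂ)).hom.homeomorph.isHomeomorph]
  refine (PrimeSpectrum.topologicalKrullDim_eq_ringKrullDim (MvPolynomial PUnit.{1} ℂ)).trans ?_
  rw [MvPolynomial.ringKrullDim_of_isNoetherianRing, ringKrullDim_eq_zero_of_field]
  simp

theorem isIrreducibleVariety_affineLine : IsIrreducibleVariety 𝔸(PUnit.{1}; SpecC) where
  isIntegral := by
    have : AlgebraicGeometry.IsIntegral
        (Spec (CommRingCat.of (MvPolynomial PUnit.{1} (CommRingCat.of ℂ)))) := inferInstance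
    exact IsIntegral.of_isIso (AffineSpace.SpecIso PUnit.{1} (CommRingCat.of ℂ)).inv
  isSeparated := inferInstanceAs (IsSeparated (𝔸(PUnit.{1}; SpecC) ↘ SpecC))
  locallyOfFiniteType := inferInstanceAs (LocallyOfFiniteType (𝔸(PUnit.{1}; SpecC) ↘ SpecC))
  quasiCompact := inferInstanceAs (QuasiCompact (𝔸(PUnit.{1}; SpecC) ↘ SpecC))

/-- A finitely generated domain over `ℂ` with a transcendental fraction is not zero-dimensional. -/
theorem ringKrullDim_ne_zero_of_transcendental {k A : Type*} [Field k] [IsAlgClosed k] [CommRing A]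
    [IsDomain A] [Algebra k A] [Algebra.FiniteType k A] {x : FractionRing A}
    (hx : Transcendental k x) : ringKrullDim A ≠ 0 := by
  intro h0
  have : Ring.KrullDimLE 0 A := Ring.krullDimLE_iff.2 (by simp [h0])
  have hmax : (⊥ : Ideal A).IsMaximal := Ideal.isMaximal_of_isPrime _
  obtain ⟨χ, hχ⟩ := exists_algHom_ker_eq (k := k) (⊥ : Ideal A)
  have hconst (a : A) : a = algebraMap k A (χ a) :=
    (RingHom.injective_iff_ker_eq_bot χ).2 hχ (by simp)
  obtain ⟨a, b, -, rfl⟩ := IsFractionRing.div_surjective (A := A) x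
  refine hx ?_
  rw [hconst a, hconst b, ← IsScalarTower.algebraMap_apply, ← IsScalarTower.algebraMap_apply,
    ← map_div₀]
  exact isAlgebraic_algebraMap _

end Dimensions

/-- On a curve with a nonconstant invariant rational function, all the actions are trivial. -/
theorem generatedGroup_eq_bot_of_transcendental {X : Scheme.{0}} [X.Over SpecC] [IsAffine X]
    [AlgebraicGeometry.IsIntegral X] [LocallyOfFiniteType (X ↘ SpecC)] {ι : Type}
    (φ : ι → AlgCAction X) (hdim : topologicalKrullDim X = 1)
    {x : FractionRing Γ(X, ⊤)} (hx : Transcendental ℂ x)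
    (hinv : ∀ h ∈ comorphismGroup (generatedGroup φ),
        IsFractionRing.fieldEquivOfAlgEquivHom ℂ (FractionRing Γ(X, ⊤)) h x = x) :
    generatedGroup φ = ⊥ := by
  rw [topologicalKrullDim_eq_of_isAffine] at hdim
  have : Ring.KrullDimLE 1 Γ(X, ⊤) := Ring.krullDimLE_iff.2 (by simp [hdim])
  refine (Subgroup.eq_bot_iff_forall _).2 fun g hg => ?_
  obtain ⟨S, hS, hSH, h1, h, hh, H⟩ := exists_isAlgebraicFamily_of_mem_generatedGroup φ hg
  obtain rfl := hS.eq_one trdeg_le_one _ hx hinv hSH h1 hh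
  refine Iso.ext (ext_of_isAffine ?_)
  ext a
  change g.hom.appTop a = (𝟙 X : X ⟶ X).appTop a
  rw [← H, Scheme.Hom.id_appTop]; rfl

theorem proposition1p1 (X : Scheme.{0}) [X.Over SpecC] [IsAffine X]
    [AlgebraicGeometry.IsIntegral X] [LocallyOfFiniteType (X ↘ SpecC)] {ι : Type} [Finite ι]
    (φ : ι → AlgCAction X)
    (hcurve : topologicalKrullDim X = 1 → generatedGroup φ ≠ ⊥)
    (horbit : ForGeneralPoint X fun x => ¬ ContainsOpenSubset (autOrbit (generatedGroup φ) x)) :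
    ∃ (XG : Scheme.{0}) (_ : XG.Over SpecC) (π : X ⤏ XG),
      IsIrreducibleVariety XG ∧
      π.IsOver SpecC ∧
      π.IsDominant ∧
      IsInvariantRationalMap (generatedGroup φ) π ∧
      0 < topologicalKrullDim XG ∧
      topologicalKrullDim XG < topologicalKrullDim X := by
  obtain ⟨x, hx, hinv⟩ := exists_transcendental_invariant φ horbit
  obtain ⟨a, b, hb, hxab⟩ := IsFractionRing.div_surjective (A := Γ(X, ⊤)) x
  have hb0 : b ≠ 0 := nonZeroDivisors.ne_zero hb
  have hbK : algebraMap Γ(X, ⊤) (FractionRing Γ(X, ⊤)) b ≠ 0 :=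
    (map_ne_zero_iff _ (IsFractionRing.injective _ _)).2 hb0
  have hxb : x * algebraMap _ _ b = algebraMap _ _ a := by
    rw [← hxab, div_mul_cancel₀ _ hbK]
  obtain ⟨s, hs⟩ := exists_mul_eq_on_basicOpen X a b
  have hdom := isDominant_partialMapOfFunction hb0 hs hx hxb
  refine ⟨𝔸(PUnit.{1}; SpecC), inferInstance, (partialMapOfFunction hb0 s).toRationalMap,
    isIrreducibleVariety_affineLine, inferInstance, inferInstance, fun g hg => ?_, ?_, ?_⟩
  · obtain ⟨S, -, hSH, -, h, hh, H⟩ := exists_isAlgebraicFamily_of_mem_generatedGroup φ hg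
    refine toRationalMap_comp_partialMapOfFunction hb0 hs g (generatedGroup_over φ hg) ?_
    have hθ (c : Γ(X, ⊤)) := IsFractionRing.fieldEquivOfAlgEquiv_algebraMap ℂ
      (FractionRing Γ(X, ⊤)) (FractionRing Γ(X, ⊤)) h c
    have hfix := hinv h (hSH hh)
    have h2 := congrArg (IsFractionRing.fieldEquivOfAlgEquivHom ℂ (FractionRing Γ(X, ⊤)) h) hxb
    rw [map_mul, hfix] at h2
    have h3 : x * algebraMap _ _ (h b) = algebraMap _ _ (h a) := by
      rw [← hθ, ← hθ]
      exact h2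
    rw [← H, ← H]
    apply IsFractionRing.injective Γ(X, ⊤) (FractionRing Γ(X, ⊤))
    rw [map_mul, map_mul, ← h3, ← hxb]
    ring
  · rw [topologicalKrullDim_affineLine]
    exact zero_lt_one
  · rw [topologicalKrullDim_affineLine]
    have h0 : topologicalKrullDim X ≠ 0 := by
      rw [topologicalKrullDim_eq_of_isAffine]
      exact ringKrullDim_ne_zero_of_transcendental hx
    have h1 : topologicalKrullDim X ≠ 1 := fun h =>
      hcurve h (generatedGroup_eq_bot_of_transcendental φ h hx hinv)
    have hpos : 0 ≤ topologicalKrullDim X := by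
      rw [topologicalKrullDim_eq_of_isAffine]
      exact ringKrullDim_nonneg_of_nontrivial
    refine lt_of_le_of_ne ?_ h1.symm
    have hlt := lt_of_le_of_ne hpos h0.symm
    generalize topologicalKrullDim X = d at hlt
    induction d with
    | bot => simp at hlt
    | coe n => exact_mod_cast Order.one_le_iff_pos.2 (by exact_mod_cast hlt)
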